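/- **Setting.** There are $n$ arms and an action size $1\le k\le n$; the actions are the sets $S\subseteq[n]$ with $|S|=k$. Arm $i$ has parameters $p_i\in(0,1]$, $v_i\in(0,1]$, with $v_1>v_2>\dots>v_n$ (the values are unknown to the learner, their order is known and is the order of the indices). In every round the outcomes are $X_i=v_iZ_i$ with $Z_i\sim\mathrm{Bernoulli}(p_i)$, independent over arms and rounds. Playing $S$ gives the reward $\max_{i\in S}X_i$, and the learner observes only this maximum and the index $i^*\in S$ attaining it (if all outcomes in $S$ are $0$, put $i^*=\infty$). Let $r_S=\mathbb E[\max_{i\in S}X_i]$ and $\mathrm{OPT}=\max_{|S|=k}r_S$. For arbitrary $p',v'\in[0,1]^n$ put $$r_S(p',v')=\sum_{i\in S}v_i'p_i'\prod_{j\in S,\,j<i}(1-p_j'),\qquad \mathrm{OPT}(p',v')=\max_{|S|=k}r_S(p',v'),$$ so that $r_S(p,v)=r_S$. For $\alpha,\beta\in(0,1]$, an $(\alpha,\beta)$-approximation oracle maps every $(p',v')\in[0,1]^n\times[0,1]^n$ to a (random) action $S$ with $\Pr[r_S(p',v')\ge\alpha\,\mathrm{OPT}(p',v')]\ge\beta$.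 **Algorithm (CUCB).** Start with $T_i=0$, $\hat p_i=\hat v_i=1$ for all $i$. In round $t=1,2,\dots$: let $\bar p_i=\min\{\hat p_i+\sqrt{3\log t/(2T_i)},\,1\}$ (so $\bar p_i=1$ if $T_i=0$) and $\bar v_i=\hat v_i$; play $S_t=\mathrm{Oracle}(\bar p,\bar v)$ (with fresh randomness) and observe the winner $i^*$ and the maximum value; if $i^*\ne\infty$, set $\hat v_{i^*}$ to the observed value; for $i\in S_t$ with $i\le i^*$ increase $T_i$ by one; then for $i\in S_t$ with $i<i^*$ set $\hat p_i\leftarrow(1-1/T_i)\hat p_i$, and, if $i^*\neq\infty$, $\hat p_{i^*}\leftarrow(1-1/T_{i^*})\hat p_{i^*}+1/T_{i^*}$. Its regret is $$R(T)=T\alpha\beta\,\mathrm{OPT}-\mathbb E\Big[\sum_{t=1}^T r_{S_t}\Big].$$ **Gaps.** Let $\Delta_S=\max\{\alpha\,\mathrm{OPT}-r_S,0\}$, $q_i^S=\prod_{j\in S,\,j<i}(1-p_j)$ and $\tilde q_i^S=q_i^Sp_i$. Let $\Delta^i_{\min}$ and $\Delta^i_{\max}$ be the minimum and the maximum of $\Delta_S$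 over the actions $S\ni i$ with $q_i^S,\tilde q_i^S>0$ and $\Delta_S>0$ ($\infty$ and $0$ respectively if there is no such action), $\Delta_{\min}=\min_i\Delta^i_{\min}$ and $\Delta_{\max}=\max_i\Delta^i_{\max}$. Here $\Delta_{\min}>0$ always, and $k/\infty=0$. **Theorem.** There are universal constants $c_1,c_2,c_3,c_4>0$ such that for all $n$, $k$, $p$, $v$, $\alpha$, $\beta$ as above, every $(\alpha,\beta)$-approximation oracle, and every $T\ge1$, $$R(T)\le c_1\sum_{i=1}^n\Big(\frac{k}{\Delta^i_{\min}}+\log\Big(\frac{k}{\Delta^i_{\min}}+1\Big)\Big)\log T+c_2\sum_{i=1}^n\Big(\Big(\log\Big(\frac{k}{\Delta^i_{\min}}+1\Big)+1\Big)\Delta_{\max}+1\Big),$$ and, for every $T\ge2$, $$R(T)\le c_3\,\frac{nk}{\Delta_{\min}}\log T\qquad\text{and}\qquad R(T)\le c_4\sqrt{nkT}\,\log T,$$ the last bound being independent of the distributions of the outcomes. -/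

import Mathlib

open Finset
open scoped ENNReal

namespace KMaxBandit

noncomputable section

/-- Binary arms `X i = v i * Z i` with `Z i` Bernoulli of parameter `p i`, the arms being listed in
the (known) decreasing order of their pairwise distinct values. -/
structure BinaryArms (n : ℕ) where
  p : Fin n → ℝ
  v : Fin n → ℝ
  p_pos : ∀ i, 0 < p i
  p_le_one : ∀ i, p i ≤ 1
  v_pos : ∀ i, 0 < v i
  v_le_one : ∀ i, v i ≤ 1
  v_strictAnti : StrictAnti v

/-- The actions: the sets of exactly `k` arms. -/
def actions (n k : ℕ) : Finset (Finset (Fin n)) := univ.powersetCard k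

/-- The maximum of the nonnegative numbers `f a`, `a ∈ s` (and `0` if `s` is empty). -/
def maxOver {ι : Type*} (s : Finset ι) (f : ι → ℝ) : ℝ := s.fold max 0 f

/-- Expectation of a real function under a distribution on a finite type. -/
def expectation {Ω : Type*} [Fintype Ω] (μ : PMF Ω) (f : Ω → ℝ) : ℝ := ∑ ω, (μ ω).toReal * f ω

/-- Outcomes of all the arms when `z i` says whether arm `i` takes its value `v i` or `0`. -/
def outcomes {n : ℕ} (v : Fin n → ℝ) (z : Fin n → Bool) (i : Fin n) : ℝ := if z i then v i else 0

/-- The reward as a function of arbitrary parameter vectors, in the known order of the arms: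
`∑_{i ∈ S} v i * p i * ∏_{j ∈ S, j < i} (1 - p j)`. For decreasing `v` this is the expected maximum of
the outcomes in `S`; the algorithm also evaluates it at estimates `v` that need not be decreasing. -/
def orderedReward {n : ℕ} (p v : Fin n → ℝ) (S : Finset (Fin n)) : ℝ :=
  ∑ i ∈ S, v i * p i * ∏ j ∈ S with j < i, (1 - p j)

/-- A (randomized) oracle: parameter vectors `p'`, `v'` are sent to the law of the returned set. -/
abbrev Oracle (n : ℕ) := (Fin n → ℝ) → (Fin n → ℝ) → PMF (Finset (Fin n))

/-- `(α, β)`-approximation oracle: on every input in `[0,1]ⁿ × [0,1]ⁿ` it returns a set of `k` arms,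
which with probability at least `β` is optimal up to the factor `α` for the given parameters. -/
def IsApproxOracle {n : ℕ} (k : ℕ) (α β : ℝ) (O : Oracle n) : Prop :=
  ∀ p' v' : Fin n → ℝ, (∀ i, p' i ∈ Set.Icc 0 1) → (∀ i, v' i ∈ Set.Icc 0 1) →
    (∀ S ∈ (O p' v').support, S ∈ actions n k) ∧
    ENNReal.ofReal β ≤ (O p' v').toOuterMeasure
      {S | α * maxOver (actions n k) (orderedReward p' v') ≤ orderedReward p' v' S}

/-! ### The learning algorithm -/

/-- The memory of the algorithm: trigger counts and estimates of the two parameter vectors. -/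
structure AlgState (n : ℕ) where
  count : Fin n → ℕ
  pHat : Fin n → ℝ
  vHat : Fin n → ℝ

/-- Initially all counts are `0` and all estimates are `1`. -/
def AlgState.init (n : ℕ) : AlgState n := ⟨fun _ => 0, fun _ => 1, fun _ => 1⟩

/-- The upper confidence bound for `p i` in round `t`. (For `count i = 0` the radius is morally
infinite; then `pHat i = 1`, so the value is `1` in either reading.) -/
def AlgState.pBar {n : ℕ} (s : AlgState n) (t : ℕ) (i : Fin n) : ℝ :=
  min (s.pHat i + √(3 * Real.log t / (2 * s.count i))) 1

/-- The upper confidence bound for `v i`. -/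
def AlgState.vBar {n : ℕ} (s : AlgState n) (i : Fin n) : ℝ := s.vHat i

/-- The winner index: the first arm of `S` whose outcome is positive and maximal over `S`; it is `⊤`,
beyond all the arms, if all outcomes in `S` are `0`. -/
def winner {n : ℕ} (S : Finset (Fin n)) (x : Fin n → ℝ) : WithTop (Fin n) :=
  (S.filter fun i => 0 < x i ∧ ∀ j ∈ S, x j ≤ x i).min

/-- Update of the memory after playing `S` and observing the winner index `w` and the maximum
value `y`: all arms of `S` up to `w` are triggered, those strictly before `w` with outcome zero. -/
def AlgState.update {n : ℕ} (s : AlgState n) (S : Finset (Fin n)) (w : WithTop (Fin n)) (y : ℝ) :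
    AlgState n :=
  let count' : Fin n → ℕ := fun i =>
    if i ∈ S ∧ (i : WithTop (Fin n)) ≤ w then s.count i + 1 else s.count i
  { count := count'
    pHat := fun i =>
      if (i : WithTop (Fin n)) = w then (1 - 1 / (count' i : ℝ)) * s.pHat i + 1 / (count' i : ℝ)
      else if i ∈ S ∧ (i : WithTop (Fin n)) < w then (1 - 1 / (count' i : ℝ)) * s.pHat i
      else s.pHat i
    vHat := fun i => if (i : WithTop (Fin n)) = w then y else s.vHat i }

/-- What happens in one round: the action played, and which arms take their nonzero value. -/
abbrev Round (n : ℕ) := Finset (Fin n) × (Fin n → Bool)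

namespace BinaryArms

variable {n : ℕ} (I : BinaryArms n)

/-- The probability that arm `i` takes its nonzero value (`b = true`), or not (`b = false`). -/
def bit (i : Fin n) (b : Bool) : ℝ≥0∞ := ENNReal.ofReal (if b then I.p i else 1 - I.p i)

theorem sum_bit (i : Fin n) : ∑ b, I.bit i b = 1 := by
  have h0 := (I.p_pos i).le
  have h1 : (0 : ℝ) ≤ 1 - I.p i := sub_nonneg.2 (I.p_le_one i)
  simp [bit, ← ENNReal.ofReal_add h0 h1]

/-- The joint law of the independent Bernoulli variables of one round. -/
def outcomeLaw : PMF (Fin n → Bool) :=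
  PMF.ofFintype (fun z => ∏ i, I.bit i (z i)) (by
    have h := Finset.prod_univ_sum (fun _ : Fin n => (univ : Finset Bool)) I.bit
    simp only [I.sum_bit, Finset.prod_const_one, Fintype.piFinset_univ] at h
    exact h.symm)

/-- Expected reward of a set: `E[max {X i | i ∈ S}]`. -/
def reward (S : Finset (Fin n)) : ℝ :=
  expectation I.outcomeLaw fun z => maxOver S (outcomes I.v z)

/-- The best expected reward of a set of `k` arms. -/
def opt (k : ℕ) : ℝ := maxOver (actions n k) I.reward

/-- The memory of the algorithm after `t` rounds. -/
def stateAfter : (t : ℕ) → (Fin t → Round n) → AlgState n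
  | 0, _ => AlgState.init n
  | t + 1, h =>
    let S := (h (Fin.last t)).1
    let x := outcomes I.v (h (Fin.last t)).2
    (stateAfter t (Fin.init h)).update S (winner S x) (maxOver S x)

/-- The law of the first `t` rounds of the algorithm: in round `t + 1` the set is returned by the
oracle on the current upper confidence bounds, and the arms are drawn independently of the past. -/
def runLaw (O : Oracle n) : (t : ℕ) → PMF (Fin t → Round n)
  | 0 => PMF.pure Fin.elim0
  | t + 1 => (runLaw O t).bind fun h =>
      (O ((I.stateAfter t h).pBar (t + 1)) (I.stateAfter t h).vBar).bind fun S =>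
        I.outcomeLaw.map fun z => Fin.snoc (α := fun _ => Round n) h (S, z)

/-- The `(α, β)`-approximation regret over `T` rounds. -/
def regret (k : ℕ) (α β : ℝ) (O : Oracle n) (T : ℕ) : ℝ :=
  T * α * β * I.opt k - expectation (I.runLaw O T) fun h => ∑ t, I.reward (h t).1

/-! ### Gaps -/

/-- The gap of a set of arms. -/
def gap (k : ℕ) (α : ℝ) (S : Finset (Fin n)) : ℝ := max (α * I.opt k - I.reward S) 0

/-- Probability that under action `S` all arms of `S` before `i` have outcome zero. -/
def q (S : Finset (Fin n)) (i : Fin n) : ℝ := ∏ j ∈ S with j < i, (1 - I.p j)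

/-- Probability that arm `i` is the winner under action `S`. -/
def qWin (S : Finset (Fin n)) (i : Fin n) : ℝ := I.q S i * I.p i

/-- The bad actions that contain and trigger arm `i`. -/
def badActions (k : ℕ) (α : ℝ) (i : Fin n) : Finset (Finset (Fin n)) :=
  (actions n k).filter fun S => i ∈ S ∧ 0 < I.q S i ∧ 0 < I.qWin S i ∧ 0 < I.gap k α S

/-- The least gap of a bad action for arm `i` (`∞` if there is none). -/
def armMinGap (k : ℕ) (α : ℝ) (i : Fin n) : ℝ≥0∞ :=
  (I.badActions k α i).inf fun S => ENNReal.ofReal (I.gap k α S)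

/-- The largest gap of a bad action for arm `i` (`0` if there is none). -/
def armMaxGap (k : ℕ) (α : ℝ) (i : Fin n) : ℝ := maxOver (I.badActions k α i) (I.gap k α)

/-- The least gap over all arms. -/
def minGap (k : ℕ) (α : ℝ) : ℝ≥0∞ := univ.inf fun i => I.armMinGap k α i

/-- The largest gap over all arms. -/
def maxGap (k : ℕ) (α : ℝ) : ℝ := maxOver univ fun i => I.armMaxGap k α i

/-- `k / Δ` for a gap `Δ` in `(0, ∞]`; it is `0` for `Δ = ∞`. -/
def ratio (k : ℕ) (α : ℝ) (i : Fin n) : ℝ := ((k : ℝ≥0∞) / I.armMinGap k α i).toReal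

theorem minGap_pos (k : ℕ) (α : ℝ) : 0 < I.minGap k α := by
  refine (Finset.lt_inf_iff ENNReal.zero_lt_top).2 fun i _ => ?_
  refine (Finset.lt_inf_iff ENNReal.zero_lt_top).2 fun S hS => ?_
  exact ENNReal.ofReal_pos.2 (Finset.mem_filter.1 hS).2.2.2.2

end BinaryArms

end

end KMaxBandit

namespace KMaxBandit

/-! ### Expectations over finite probability spaces -/

section Expectation

variable {Ω Ω' : Type*} [Fintype Ω] [Fintype Ω']

/-! The regret is paid for by a potential whose expected increase is known exactly, so the sum over
rounds telescopes. While the confidence intervals hold, the estimates are optimistic: the bounds on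
`p` dominate the truth, and the value estimate of an arm is 1 until its first win and `v i` from
then on. If the oracle succeeds, monotonicity and smoothness of the reward (`orderedReward_sub_le`)
bound the gap of `S` by the sum over `i ∈ S` of `q S i * (ρ i + p i * (vHat i - v i))`, with `ρ i`
the confidence width. Here `q S i` is the probability that arm `i` is triggered, and `q S i * p i`
the probability that it wins. Let thresholds satisfy `∑ q S i * θ i ≤ gap + B`. Writing the gap as
twice itself minus itself replaces `ρ i` by the positive part of `2 * ρ i - θ i`, which vanishes
after order `log T / θ i ^ 2` triggers. Up to `B`, what remains is the expected one-round increase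
of a sum over arms: the excess widths consumed so far, minus `2 * vHat i`
(`expectation_armPotential_next`). This potential starts at `-2n` and is at most `∑ (2 + 48 * log T
/ θ i)` (`sum_excess_le`). Rounds with a wrong interval cost `O(n)` times the largest gap in total
(`stateMean_not_concentrated_le`). Together these give `regret_le_of_threshold`. Thresholds equal to
the least gap of the arm over `k`, with `B = 0`, give the gap-dependent bounds; a constant threshold
`ε` with `B = k * ε` gives the distribution-free one. -/

theorem sum_toReal_eq_one (μ : PMF Ω) : ∑ ω, (μ ω).toReal = 1 := by
  rw [← ENNReal.toReal_sum fun ω _ => μ.apply_ne_top ω, ← tsum_fintype (L := .unconditional Ω),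
    μ.tsum_coe, ENNReal.toReal_one]

theorem expectation_const (μ : PMF Ω) (c : ℝ) : expectation μ (fun _ => c) = c := by
  simp [expectation, ← Finset.sum_mul, sum_toReal_eq_one]

theorem expectation_add (μ : PMF Ω) (f g : Ω → ℝ) :
    expectation μ (fun ω => f ω + g ω) = expectation μ f + expectation μ g := by
  simp [expectation, mul_add, Finset.sum_add_distrib]

theorem expectation_sub (μ : PMF Ω) (f g : Ω → ℝ) :
    expectation μ (fun ω => f ω - g ω) = expectation μ f - expectation μ g := by
  simp [expectation, mul_sub, Finset.sum_sub_distrib]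

theorem expectation_const_mul (μ : PMF Ω) (c : ℝ) (f : Ω → ℝ) :
    expectation μ (fun ω => c * f ω) = c * expectation μ f := by
  simp [expectation, Finset.mul_sum, mul_left_comm]

theorem expectation_sum {ι : Type*} (μ : PMF Ω) (s : Finset ι) (f : ι → Ω → ℝ) :
    expectation μ (fun ω => ∑ i ∈ s, f i ω) = ∑ i ∈ s, expectation μ (f i) := by
  simp only [expectation, Finset.mul_sum]
  exact Finset.sum_comm

theorem expectation_mono_support (μ : PMF Ω) {f g : Ω → ℝ} (h : ∀ ω ∈ μ.support, f ω ≤ g ω) :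
    expectation μ f ≤ expectation μ g := by
  refine Finset.sum_le_sum fun ω _ => ?_
  by_cases hω : μ ω = 0
  · simp [hω]
  · exact mul_le_mul_of_nonneg_left (h ω ((μ.mem_support_iff ω).2 hω)) ENNReal.toReal_nonneg

theorem expectation_mono (μ : PMF Ω) {f g : Ω → ℝ} (h : ∀ ω, f ω ≤ g ω) :
    expectation μ f ≤ expectation μ g := expectation_mono_support μ fun ω _ => h ω

theorem expectation_pure (a : Ω) (f : Ω → ℝ) : expectation (PMF.pure a) f = f a := by
  classical
  simp [expectation, PMF.pure_apply, apply_ite ENNReal.toReal]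

theorem expectation_bind (μ : PMF Ω) (κ : Ω → PMF Ω') (f : Ω' → ℝ) :
    expectation (μ.bind κ) f = expectation μ fun ω => expectation (κ ω) f := by
  simp only [expectation, PMF.bind_apply, tsum_fintype, Finset.mul_sum]
  rw [Finset.sum_comm]
  refine Finset.sum_congr rfl fun ω' _ => ?_
  rw [ENNReal.toReal_sum fun ω _ => ENNReal.mul_ne_top (μ.apply_ne_top ω) ((κ ω).apply_ne_top ω'),
    Finset.sum_mul]
  simp [mul_assoc]

theorem expectation_map (μ : PMF Ω) (g : Ω → Ω') (f : Ω' → ℝ) :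
    expectation (μ.map g) f = expectation μ fun ω => f (g ω) := by
  rw [← PMF.bind_pure_comp, expectation_bind]
  simp [expectation_pure]

theorem le_expectation_indicator (μ : PMF Ω) {A : Set Ω} {b : ℝ}
    (h : ENNReal.ofReal b ≤ μ.toOuterMeasure A) :
    b ≤ expectation μ (A.indicator 1) := by
  have htop : μ.toOuterMeasure A ≠ ∞ := by
    rw [PMF.toOuterMeasure_apply_fintype]
    refine ENNReal.sum_ne_top.2 fun ω _ => ?_
    by_cases hω : ω ∈ A <;> simp [hω, μ.apply_ne_top]
  refine ((ENNReal.ofReal_le_iff_le_toReal htop).1 h).trans_eq ?_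
  rw [PMF.toOuterMeasure_apply_fintype, ENNReal.toReal_sum]
  · refine Finset.sum_congr rfl fun ω _ => ?_
    by_cases hω : ω ∈ A <;> simp [hω]
  · intro ω _
    by_cases hω : ω ∈ A <;> simp [hω, μ.apply_ne_top]

end Expectation

/-! ### Maxima of nonnegative numbers -/

section MaxOver

variable {ι : Type*} {s : Finset ι} {f g : ι → ℝ} {c : ℝ}

theorem maxOver_le_iff : maxOver s f ≤ c ↔ 0 ≤ c ∧ ∀ i ∈ s, f i ≤ c := Finset.fold_max_le c

theorem maxOver_nonneg (s : Finset ι) (f : ι → ℝ) : 0 ≤ maxOver s f := (maxOver_le_iff.1 le_rfl).1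

theorem le_maxOver {i : ι} (hi : i ∈ s) : f i ≤ maxOver s f := (maxOver_le_iff.1 le_rfl).2 i hi

theorem maxOver_mono (h : ∀ i ∈ s, f i ≤ g i) : maxOver s f ≤ maxOver s g :=
  maxOver_le_iff.2 ⟨maxOver_nonneg s g, fun i hi => (h i hi).trans (le_maxOver hi)⟩

end MaxOver

/-! ### The ordered reward as a function of the parameters -/

section OrderedReward

variable {n : ℕ} {p p' v v' : Fin n → ℝ}

theorem filter_lt_insert_min {a : Fin n} {s : Finset (Fin n)} (ha : ∀ x ∈ s, a < x) :
    ((insert a s).filter fun j => j < a) = ∅ := by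
  refine Finset.filter_eq_empty_iff.2 fun j hj => not_lt.2 ?_
  rcases Finset.mem_insert.1 hj with rfl | hj
  exacts [le_rfl, (ha j hj).le]

/-- Conditioning on the least arm: every later arm carries the factor `1 - p a`. The weights `c` are
free so that the reward and the smoothness bound obey the same recursion. -/
theorem sum_insert_min {a : Fin n} {s : Finset (Fin n)} (ha : ∀ x ∈ s, a < x)
    (p c : Fin n → ℝ) :
    ∑ i ∈ insert a s, c i * ∏ j ∈ insert a s with j < i, (1 - p j) =
      c a + (1 - p a) * ∑ i ∈ s, c i * ∏ j ∈ s with j < i, (1 - p j) := by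
  have has : a ∉ s := fun h => lt_irrefl a (ha a h)
  rw [Finset.sum_insert has, filter_lt_insert_min ha, Finset.prod_empty, mul_one, Finset.mul_sum]
  congr 1
  refine Finset.sum_congr rfl fun i hi => ?_
  rw [Finset.filter_insert, if_pos (ha i hi), Finset.prod_insert (by simp [has])]
  ring

theorem orderedReward_insert_min {a : Fin n} {s : Finset (Fin n)} (ha : ∀ x ∈ s, a < x)
    (p v : Fin n → ℝ) :
    orderedReward p v (insert a s) = v a * p a + (1 - p a) * orderedReward p v s :=
  sum_insert_min ha p fun i => v i * p i

theorem orderedReward_nonneg (hp : ∀ i, p i ∈ Set.Icc (0 : ℝ) 1) (hv : ∀ i, 0 ≤ v i)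
    (S : Finset (Fin n)) : 0 ≤ orderedReward p v S :=
  Finset.sum_nonneg fun i _ => mul_nonneg (mul_nonneg (hv i) (hp i).1)
    (Finset.prod_nonneg fun j _ => sub_nonneg.2 (hp j).2)

theorem orderedReward_le (hp : ∀ i, p i ∈ Set.Icc (0 : ℝ) 1) {M : ℝ} (hM : 0 ≤ M)
    (S : Finset (Fin n)) (hv : ∀ i ∈ S, v i ≤ M) : orderedReward p v S ≤ M := by
  induction S using Finset.induction_on_min with
  | empty => simpa [orderedReward]
  | insert a s ha ih =>
    rw [orderedReward_insert_min ha]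
    have h1 := hv a (Finset.mem_insert_self a s)
    have h2 := ih fun i hi => hv i (Finset.mem_insert_of_mem hi)
    nlinarith [(hp a).1, (hp a).2]

/-- Raising `p a` trades the reward of the later arms for `v a`. This is a gain only because the
values decrease, which is why `v` must be antitone. -/
theorem orderedReward_mono_left (hp : ∀ i, p i ∈ Set.Icc (0 : ℝ) 1)
    (hp' : ∀ i, p' i ∈ Set.Icc (0 : ℝ) 1) (hpp : ∀ i, p i ≤ p' i) (hv : ∀ i, 0 ≤ v i)
    (hanti : Antitone v) (S : Finset (Fin n)) : orderedReward p v S ≤ orderedReward p' v S := by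
  induction S using Finset.induction_on_min with
  | empty => simp [orderedReward]
  | insert a s ha ih =>
    rw [orderedReward_insert_min ha, orderedReward_insert_min ha]
    have h1 : orderedReward p' v s ≤ v a :=
      orderedReward_le hp' (hv a) s fun i hi => hanti (ha i hi).le
    nlinarith [(hp a).2, hpp a, mul_nonneg (sub_nonneg.2 (hpp a)) (sub_nonneg.2 h1),
      mul_nonneg (sub_nonneg.2 (hp a).2) (sub_nonneg.2 ih)]

theorem orderedReward_mono_right (hp : ∀ i, p i ∈ Set.Icc (0 : ℝ) 1) (hvv : ∀ i, v i ≤ v' i)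
    (S : Finset (Fin n)) : orderedReward p v S ≤ orderedReward p v' S :=
  Finset.sum_le_sum fun i _ => mul_le_mul_of_nonneg_right
    (mul_le_mul_of_nonneg_right (hvv i) (hp i).1)
    (Finset.prod_nonneg fun j _ => sub_nonneg.2 (hp j).2)

/-- Smoothness of the reward, modulated by the triggering probabilities. -/
theorem orderedReward_sub_le (hp : ∀ i, p i ∈ Set.Icc (0 : ℝ) 1)
    (hp' : ∀ i, p' i ∈ Set.Icc (0 : ℝ) 1) (hpp : ∀ i, p i ≤ p' i)
    (hv' : ∀ i, v' i ∈ Set.Icc (0 : ℝ) 1) (S : Finset (Fin n)) :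
    orderedReward p' v' S - orderedReward p v S ≤
      ∑ i ∈ S, ((p' i - p i) + p i * (v' i - v i)) * ∏ j ∈ S with j < i, (1 - p j) := by
  induction S using Finset.induction_on_min with
  | empty => simp [orderedReward]
  | insert a s ha ih =>
    rw [orderedReward_insert_min ha, orderedReward_insert_min ha, sum_insert_min ha]
    have h1 : 0 ≤ orderedReward p' v' s := orderedReward_nonneg hp' (fun i => (hv' i).1) s
    -- With `R'`, `R` the rewards of `s`, the difference is `(p' a - p a) * (v' a - R') + p a * (v'
    -- a - v a) + (1 - p a) * (R' - R)`, and `v' a - R' ≤ 1`. No order of `v'` is needed.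
    nlinarith [mul_nonneg (sub_nonneg.2 (hpp a)) h1,
      mul_nonneg (sub_nonneg.2 (hpp a)) (sub_nonneg.2 (hv' a).2),
      mul_nonneg (sub_nonneg.2 (hp a).2) (sub_nonneg.2 ih)]

end OrderedReward

/-! ### One round -/

/-- Arm `i` of `S` is triggered: all earlier arms of `S` have outcome zero. -/
def Triggered {n : ℕ} (S : Finset (Fin n)) (z : Fin n → Bool) (i : Fin n) : Prop :=
  i ∈ S ∧ ∀ j ∈ S, j < i → z j = false

instance {n : ℕ} (S : Finset (Fin n)) (z : Fin n → Bool) (i : Fin n) :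
    Decidable (Triggered S z i) := inferInstanceAs (Decidable (_ ∧ _))

namespace BinaryArms

variable {n : ℕ} (I : BinaryArms n)

theorem p_mem_Icc (i : Fin n) : I.p i ∈ Set.Icc (0 : ℝ) 1 := ⟨(I.p_pos i).le, I.p_le_one i⟩

theorem q_nonneg (S : Finset (Fin n)) (i : Fin n) : 0 ≤ I.q S i :=
  Finset.prod_nonneg fun j _ => sub_nonneg.2 (I.p_le_one j)

theorem q_le_one (S : Finset (Fin n)) (i : Fin n) : I.q S i ≤ 1 :=
  Finset.prod_le_one (fun j _ => sub_nonneg.2 (I.p_le_one j)) fun j _ => by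
    linarith [I.p_pos j]

theorem expectation_prod (φ : Fin n → Bool → ℝ) :
    expectation I.outcomeLaw (fun z => ∏ j, φ j (z j)) =
      ∏ j, (I.p j * φ j true + (1 - I.p j) * φ j false) := by
  have h := Finset.prod_univ_sum (fun _ : Fin n => (univ : Finset Bool))
    fun j b => (I.bit j b).toReal * φ j b
  simp only [Fintype.piFinset_univ, Fintype.sum_bool, Finset.prod_mul_distrib] at h
  have hb (j : Fin n) : (I.bit j true).toReal * φ j true + (I.bit j false).toReal * φ j false =
      I.p j * φ j true + (1 - I.p j) * φ j false := by
    simp [bit, ENNReal.toReal_ofReal (I.p_pos j).le,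
      ENNReal.toReal_ofReal (sub_nonneg.2 (I.p_le_one j))]
  simp only [hb] at h
  rw [h]
  simp [expectation, outcomeLaw, PMF.ofFintype_apply, ENNReal.toReal_prod]

/-- A triggered arm still has its original law. -/
theorem expectation_triggered {S : Finset (Fin n)} {i : Fin n} (hi : i ∈ S) (g : Bool → ℝ)
    (c : ℝ) :
    expectation I.outcomeLaw (fun z => if Triggered S z i then g (z i) else c) =
      I.q S i * (I.p i * g true + (1 - I.p i) * g false) + (1 - I.q S i) * c := by
  -- After subtracting `c`, the integrand is a product of one factor per arm, so independence
  -- applies.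
  set φ : Fin n → Bool → ℝ := fun j b =>
    (if j ∈ S ∧ j < i then (if b then 0 else 1) else 1) * (if j = i then g b - c else 1) with hφ
  have hpath (z : Fin n → Bool) :
      (if Triggered S z i then g (z i) else c) = c + ∏ j, φ j (z j) := by
    simp only [hφ, Finset.prod_mul_distrib, Finset.prod_ite_eq', Finset.mem_univ, if_true]
    by_cases h : Triggered S z i
    · rw [if_pos h, Finset.prod_eq_one, one_mul]
      · ring
      · intro j _
        split_ifs with h1 h2
        · simp [h.2 j h1.1 h1.2] at h2
        all_goals rfl
    · have : ∃ j ∈ S, j < i ∧ z j = true := by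
        by_contra! h'
        exact h ⟨hi, fun j hj hji => by simpa using h' j hj hji⟩
      obtain ⟨j, hj, hji, hz⟩ := this
      rw [if_neg h, Finset.prod_eq_zero (Finset.mem_univ j) (by simp [hj, hji, hz])]
      simp
  simp only [hpath]
  rw [expectation_add, expectation_const, I.expectation_prod]
  have hfac (j : Fin n) : I.p j * φ j true + (1 - I.p j) * φ j false =
      (if j ∈ S ∧ j < i then 1 - I.p j else 1) *
        (if j = i then I.p i * (g true - c) + (1 - I.p i) * (g false - c) else 1) := by
    simp only [hφ]
    by_cases h1 : j = i
    · subst h1; simp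
    · by_cases h2 : j ∈ S ∧ j < i <;> simp [h1, h2]
  simp only [hfac, Finset.prod_mul_distrib, Finset.prod_ite_eq', Finset.mem_univ, if_true]
  rw [← Finset.prod_filter]
  have : (univ.filter fun j => j ∈ S ∧ j < i) = S.filter fun j => j < i := by ext; simp
  rw [this, ← q]
  ring

/-- For a fixed outcome the maximum is the ordered reward with 0/1 probabilities, since the values
decrease; its products are then the indicators of being triggered. -/
theorem maxOver_outcomes (z : Fin n → Bool) (S : Finset (Fin n)) :
    maxOver S (outcomes I.v z) = ∑ i ∈ S, I.v i * (if Triggered S z i then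
      (if z i then 1 else 0) else 0) := by
  have hpath : maxOver S (outcomes I.v z) =
      orderedReward (fun i => if z i then 1 else 0) I.v S := by
    induction S using Finset.induction_on_min with
    | empty => simp [orderedReward, maxOver]
    | insert a s ha ih =>
      have has : a ∉ s := fun h => lt_irrefl a (ha a h)
      rw [orderedReward_insert_min ha, ← ih, maxOver, Finset.fold_insert has, ← maxOver]
      by_cases hz : z a
      · have : maxOver s (outcomes I.v z) ≤ I.v a := by
          refine maxOver_le_iff.2 ⟨(I.v_pos a).le, fun i hi => ?_⟩
          unfold outcomes
          split_ifs
          exacts [I.v_strictAnti.antitone (ha i hi).le, (I.v_pos a).le]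
        simp [hz, outcomes]
        exact this
      · simp [hz, outcomes]
        exact maxOver_nonneg s _
  rw [hpath, orderedReward]
  refine Finset.sum_congr rfl fun i hi => ?_
  rw [mul_assoc]
  congr 1
  by_cases h : Triggered S z i
  · rw [if_pos h, Finset.prod_eq_one, mul_one]
    intro j hj
    rw [Finset.mem_filter] at hj
    simp [h.2 j hj.1 hj.2]
  · have : ∃ j ∈ S, j < i ∧ z j = true := by
      by_contra! h'
      exact h ⟨hi, fun j hj hji => by simpa using h' j hj hji⟩
    obtain ⟨j, hj, hji, hz⟩ := this
    rw [if_neg h, Finset.prod_eq_zero (Finset.mem_filter.2 ⟨hj, hji⟩) (by simp [hz]), mul_zero]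

theorem reward_eq_orderedReward (S : Finset (Fin n)) :
    I.reward S = orderedReward I.p I.v S := by
  simp only [reward, I.maxOver_outcomes]
  rw [expectation_sum]
  refine Finset.sum_congr rfl fun i hi => ?_
  rw [expectation_const_mul, I.expectation_triggered hi (fun b => if b then 1 else 0) 0, ← q]
  simp
  ring

theorem reward_nonneg (S : Finset (Fin n)) : 0 ≤ I.reward S := by
  rw [I.reward_eq_orderedReward]
  exact orderedReward_nonneg I.p_mem_Icc (fun i => (I.v_pos i).le) S

theorem opt_nonneg (k : ℕ) : 0 ≤ I.opt k := maxOver_nonneg _ _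

theorem opt_le_one (k : ℕ) : I.opt k ≤ 1 := by
  refine maxOver_le_iff.2 ⟨zero_le_one, fun S _ => ?_⟩
  rw [I.reward_eq_orderedReward]
  exact orderedReward_le I.p_mem_Icc zero_le_one S fun i _ => I.v_le_one i

/-! ### The evolution of the memory -/

theorem outcomes_le (z : Fin n → Bool) {i j : Fin n} (h : i ≤ j) :
    outcomes I.v z j ≤ I.v i := by
  unfold outcomes
  split_ifs
  exacts [I.v_strictAnti.antitone h, (I.v_pos i).le]

theorem mem_winner_filter {S : Finset (Fin n)} {z : Fin n → Bool} {i : Fin n}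
    (h : Triggered S z i) (hz : z i = true) :
    i ∈ S.filter fun i => 0 < outcomes I.v z i ∧ ∀ j ∈ S, outcomes I.v z j ≤ outcomes I.v z i := by
  have hx : outcomes I.v z i = I.v i := by simp [outcomes, hz]
  refine Finset.mem_filter.2 ⟨h.1, by rw [hx]; exact I.v_pos i, fun j hj => ?_⟩
  rw [hx]
  rcases lt_or_ge j i with hji | hij
  · simp [outcomes, h.2 j hj hji, (I.v_pos i).le]
  · exact I.outcomes_le z hij

/-- As the values decrease, the winner is the first arm of `S` with nonzero outcome. This turns the
update rule into statements about `Triggered`. -/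
theorem coe_le_winner_iff {S : Finset (Fin n)} {z : Fin n → Bool} {i : Fin n} :
    (i : WithTop (Fin n)) ≤ winner S (outcomes I.v z) ↔ ∀ j ∈ S, j < i → z j = false := by
  constructor
  · intro h j hj hji
    by_contra hz
    have hne : (S.filter fun j => z j = true).Nonempty :=
      ⟨j, Finset.mem_filter.2 ⟨hj, by simpa using hz⟩⟩
    set m := (S.filter fun j => z j = true).min' hne with hm
    have hmem := Finset.mem_filter.1 (Finset.min'_mem _ hne)
    have hmj : m ≤ j := Finset.min'_le _ _ (Finset.mem_filter.2 ⟨hj, by simpa using hz⟩)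
    have htr : Triggered S z m := by
      refine ⟨hmem.1, fun l hl hlm => ?_⟩
      by_contra hzl
      exact absurd (Finset.min'_le _ l (Finset.mem_filter.2 ⟨hl, by simpa using hzl⟩))
        (not_le.2 hlm)
    have := h.trans (Finset.min_le (I.mem_winner_filter htr hmem.2))
    exact absurd (WithTop.coe_le_coe.1 this) (not_le.2 (hmj.trans_lt hji))
  · intro h
    refine Finset.le_min fun m hm => WithTop.coe_le_coe.2 ?_
    obtain ⟨hmS, hpos, -⟩ := Finset.mem_filter.1 hm
    by_contra hlt
    simp [outcomes, h m hmS (not_le.1 hlt)] at hpos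

theorem coe_eq_winner_iff {S : Finset (Fin n)} {z : Fin n → Bool} {i : Fin n} :
    (i : WithTop (Fin n)) = winner S (outcomes I.v z) ↔ Triggered S z i ∧ z i = true := by
  constructor
  · intro h
    obtain ⟨hiS, hpos, -⟩ := Finset.mem_filter.1 (Finset.mem_of_min h.symm)
    refine ⟨⟨hiS, I.coe_le_winner_iff.1 h.le⟩, ?_⟩
    by_contra hz
    simp [outcomes, hz] at hpos
  · rintro ⟨h, hz⟩
    exact le_antisymm (I.coe_le_winner_iff.2 h.2) (Finset.min_le (I.mem_winner_filter h hz))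

theorem maxOver_outcomes_of_triggered {S : Finset (Fin n)} {z : Fin n → Bool} {i : Fin n}
    (h : Triggered S z i) (hz : z i = true) : maxOver S (outcomes I.v z) = I.v i := by
  have hx : outcomes I.v z i = I.v i := by simp [outcomes, hz]
  refine le_antisymm (maxOver_le_iff.2 ⟨(I.v_pos i).le, fun j hj => ?_⟩) (hx ▸ le_maxOver h.1)
  exact hx ▸ (Finset.mem_filter.1 (I.mem_winner_filter h hz)).2.2 j hj

/-- The memory after one more round. -/
noncomputable def next (s : AlgState n) (S : Finset (Fin n)) (z : Fin n → Bool) : AlgState n :=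
  s.update S (winner S (outcomes I.v z)) (maxOver S (outcomes I.v z))

theorem next_count (s : AlgState n) (S : Finset (Fin n)) (z : Fin n → Bool) (i : Fin n) :
    (I.next s S z).count i = if Triggered S z i then s.count i + 1 else s.count i := by
  simp only [next, AlgState.update, I.coe_le_winner_iff]
  exact if_congr Iff.rfl rfl rfl

theorem next_vHat (s : AlgState n) (S : Finset (Fin n)) (z : Fin n → Bool) (i : Fin n) :
    (I.next s S z).vHat i =
      if Triggered S z i then (if z i then I.v i else s.vHat i) else s.vHat i := by
  simp only [next, AlgState.update, I.coe_eq_winner_iff]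
  by_cases h : Triggered S z i
  · by_cases hz : z i = true
    · simpa [h, hz] using I.maxOver_outcomes_of_triggered h hz
    · simp [hz]
  · simp [h]

/-- The update is a running mean. The initial value 1 enters with weight `count = 0`, so it leaves
no bias after the first trigger. -/
theorem next_pHat (s : AlgState n) (S : Finset (Fin n)) (z : Fin n → Bool) (i : Fin n) :
    (I.next s S z).pHat i = if Triggered S z i then
      (s.count i * s.pHat i + if z i then 1 else 0) / (s.count i + 1) else s.pHat i := by
  have hc : ((I.next s S z).count i : ℝ) =
      if Triggered S z i then (s.count i : ℝ) + 1 else s.count i := by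
    rw [I.next_count]; split_ifs <;> simp
  have hpos : (0 : ℝ) < s.count i + 1 := by positivity
  have hlt : (i ∈ S ∧ (i : WithTop (Fin n)) < winner S (outcomes I.v z)) ↔
      Triggered S z i ∧ z i = false := by
    rw [lt_iff_le_and_ne, Ne, I.coe_le_winner_iff, I.coe_eq_winner_iff, Triggered]
    cases z i <;> simp; tauto
  change (if (i : WithTop (Fin n)) = winner S (outcomes I.v z) then
      (1 - 1 / ((I.next s S z).count i : ℝ)) * s.pHat i + 1 / ((I.next s S z).count i : ℝ)
    else if i ∈ S ∧ (i : WithTop (Fin n)) < winner S (outcomes I.v z) then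
      (1 - 1 / ((I.next s S z).count i : ℝ)) * s.pHat i else s.pHat i) = _
  simp only [hc, I.coe_eq_winner_iff, hlt]
  by_cases h : Triggered S z i <;> by_cases hz : z i = true <;> simp [h, hz] <;> field_simp <;> ring

end BinaryArms

end KMaxBandit

/-- Hoeffding's lemma for a Bernoulli variable. -/
theorem bernoulli_mgf_le {p : ℝ} (hp : p ∈ Set.Icc (0 : ℝ) 1) (l : ℝ) :
    p * Real.exp (l * (1 - p)) + (1 - p) * Real.exp (l * (0 - p)) ≤ Real.exp (l ^ 2 / 8) := by
  have hp1 : 0 ≤ 1 - p := sub_nonneg.2 hp.2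
  let μ : MeasureTheory.Measure Bool :=
    ENNReal.ofReal p • MeasureTheory.Measure.dirac true +
      ENNReal.ofReal (1 - p) • MeasureTheory.Measure.dirac false
  have hμ : MeasureTheory.IsProbabilityMeasure μ := by
    refine ⟨?_⟩
    simp [μ, ← ENNReal.ofReal_add hp.1 hp1]
  have hint (f : Bool → ℝ) : ∫ b, f b ∂μ = p * f true + (1 - p) * f false := by
    have h1 : MeasureTheory.IsFiniteMeasure
        (ENNReal.ofReal p • MeasureTheory.Measure.dirac true) :=
      MeasureTheory.Measure.smul_finite _ ENNReal.ofReal_ne_top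
    have h2 : MeasureTheory.IsFiniteMeasure
        (ENNReal.ofReal (1 - p) • MeasureTheory.Measure.dirac false) :=
      MeasureTheory.Measure.smul_finite _ ENNReal.ofReal_ne_top
    rw [MeasureTheory.integral_add_measure (.of_finite ..) (.of_finite ..),
      MeasureTheory.integral_smul_measure, MeasureTheory.integral_smul_measure,
      MeasureTheory.integral_dirac, MeasureTheory.integral_dirac, ENNReal.toReal_ofReal hp.1,
      ENNReal.toReal_ofReal hp1]
    rfl
  have h := (ProbabilityTheory.hasSubgaussianMGF_of_mem_Icc (μ := μ) (a := 0) (b := 1)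
    (X := fun b : Bool => if b then (1 : ℝ) else 0) (Measurable.of_discrete).aemeasurable
    (.of_forall fun b => by cases b <;> simp)).mgf_le l
  rw [ProbabilityTheory.mgf, hint, hint] at h
  refine (le_of_eq ?_).trans (h.trans (le_of_eq ?_))
  · simp
  · congr 1
    simp
    ring

/-! ### Recursions over the rounds for the run, the memory and the regret. -/

namespace KMaxBandit.BinaryArms

variable {n : ℕ} (I : BinaryArms n) (O : Oracle n)

theorem expectation_runLaw_succ (t : ℕ) (F : (Fin (t + 1) → Round n) → ℝ) :
    expectation (I.runLaw O (t + 1)) F = expectation (I.runLaw O t) fun h =>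
      expectation (O ((I.stateAfter t h).pBar (t + 1)) (I.stateAfter t h).vBar) fun S =>
        expectation I.outcomeLaw fun z => F (Fin.snoc (α := fun _ => Round n) h (S, z)) := by
  rw [runLaw, expectation_bind]
  simp only [expectation_bind, expectation_map]

theorem stateAfter_snoc (t : ℕ) (h : Fin t → Round n) (S : Finset (Fin n)) (z : Fin n → Bool) :
    I.stateAfter (t + 1) (Fin.snoc (α := fun _ => Round n) h (S, z)) =
      I.next (I.stateAfter t h) S z := by
  simp [stateAfter, next]

/-- Expectation of a function of the memory after `t` rounds. -/
noncomputable def stateMean (t : ℕ) (φ : AlgState n → ℝ) : ℝ :=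
  expectation (I.runLaw O t) fun h => φ (I.stateAfter t h)

theorem stateMean_const (t : ℕ) (c : ℝ) : I.stateMean O t (fun _ => c) = c :=
  expectation_const _ c

theorem stateMean_zero (φ : AlgState n → ℝ) : I.stateMean O 0 φ = φ (AlgState.init n) :=
  expectation_pure _ _

theorem stateMean_succ (t : ℕ) (φ : AlgState n → ℝ) :
    I.stateMean O (t + 1) φ = I.stateMean O t fun s =>
      expectation (O (s.pBar (t + 1)) s.vBar) fun S =>
        expectation I.outcomeLaw fun z => φ (I.next s S z) := by
  rw [stateMean, expectation_runLaw_succ]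
  simp only [stateAfter_snoc]
  rfl

theorem regret_zero (k : ℕ) (α β : ℝ) : I.regret k α β O 0 = 0 := by
  simp [regret, expectation_const]

theorem regret_succ (k : ℕ) (α β : ℝ) (t : ℕ) :
    I.regret k α β O (t + 1) = I.regret k α β O t + I.stateMean O t fun s =>
      α * β * I.opt k - expectation (O (s.pBar (t + 1)) s.vBar) I.reward := by
  simp only [regret, stateMean, expectation_runLaw_succ, Fin.sum_univ_castSucc, Fin.snoc_castSucc,
    Fin.snoc_last, expectation_add, expectation_const, expectation_sub]
  push_cast
  ring

/-! ### Invariants of the memory -/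

/-- What holds for the memory after `t` rounds whatever happened. -/
structure Valid (t : ℕ) (s : AlgState n) : Prop where
  count_le : ∀ i, s.count i ≤ t
  pHat_mem : ∀ i, s.pHat i ∈ Set.Icc (0 : ℝ) 1
  vHat_mem : ∀ i, s.vHat i ∈ Set.Icc (I.v i) 1
  pHat_eq_one : ∀ i, s.count i = 0 → s.pHat i = 1

variable {I} in
theorem Valid.next {t : ℕ} {s : AlgState n} (h : I.Valid t s) (S : Finset (Fin n))
    (z : Fin n → Bool) : I.Valid (t + 1) (I.next s S z) where
  count_le i := by
    rw [next_count]
    have := h.count_le i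
    split_ifs <;> omega
  pHat_mem i := by
    rw [next_pHat]
    have hpos : (0 : ℝ) < s.count i + 1 := by positivity
    have h0 := mul_nonneg (Nat.cast_nonneg (α := ℝ) (s.count i)) (h.pHat_mem i).1
    have h1 := mul_le_mul_of_nonneg_left (h.pHat_mem i).2 (Nat.cast_nonneg (α := ℝ) (s.count i))
    by_cases ht : Triggered S z i
    · rw [if_pos ht, Set.mem_Icc, le_div_iff₀ hpos, div_le_iff₀ hpos]
      split_ifs <;> constructor <;> linarith
    · rw [if_neg ht]; exact h.pHat_mem i
  vHat_mem i := by
    rw [next_vHat]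
    split_ifs
    exacts [⟨le_rfl, I.v_le_one i⟩, h.vHat_mem i, h.vHat_mem i]
  pHat_eq_one i := by
    rw [next_count, next_pHat]
    split_ifs
    exacts [by simp, by simp, h.pHat_eq_one i]

theorem valid_stateAfter (t : ℕ) (h : Fin t → Round n) : I.Valid t (I.stateAfter t h) := by
  induction t with
  | zero => exact ⟨fun _ => le_rfl, fun _ => ⟨zero_le_one, le_rfl⟩, fun i => ⟨I.v_le_one i, le_rfl⟩,
      fun _ _ => rfl⟩
  | succ t ih => exact (ih (Fin.init h)).next _ _

theorem stateMean_mono (t : ℕ) {φ ψ : AlgState n → ℝ} (h : ∀ s, I.Valid t s → φ s ≤ ψ s) :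
    I.stateMean O t φ ≤ I.stateMean O t ψ :=
  expectation_mono _ fun _ => h _ (I.valid_stateAfter t _)

/-! ### Concentration of the estimates of `p` -/

/-- The exponential supermartingale of Hoeffding's inequality. -/
noncomputable def expDev (l : ℝ) (i : Fin n) (s : AlgState n) : ℝ :=
  Real.exp (l * (s.count i * (s.pHat i - I.p i)) - l ^ 2 / 8 * s.count i)

/-- A trigger adds one fresh centred Bernoulli variable to `count * (pHat - p)`, and Hoeffding's
factor cancels `exp (-(l ^ 2 / 8))`; otherwise nothing changes. The bound holds for every `S`, so
the adaptive choice of actions is harmless. -/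
theorem expectation_expDev_next_le (l : ℝ) (i : Fin n) (s : AlgState n) (S : Finset (Fin n)) :
    expectation I.outcomeLaw (fun z => I.expDev l i (I.next s S z)) ≤ I.expDev l i s := by
  have hpos : (s.count i : ℝ) + 1 ≠ 0 := by positivity
  have hpath (z : Fin n → Bool) : I.expDev l i (I.next s S z) = if Triggered S z i then
      I.expDev l i s * (Real.exp (-(l ^ 2 / 8)) *
        Real.exp (l * ((if z i then 1 else 0) - I.p i))) else I.expDev l i s := by
    rw [expDev, next_count, next_pHat]
    split_ifs
    all_goals simp only [expDev, ← Real.exp_add, Real.exp_eq_exp]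
    all_goals (push_cast; field_simp; ring)
  simp only [hpath]
  by_cases hi : i ∈ S
  · rw [I.expectation_triggered hi (fun b => I.expDev l i s * (Real.exp (-(l ^ 2 / 8)) *
      Real.exp (l * ((if b then 1 else 0) - I.p i))))]
    have hE : 0 < I.expDev l i s := Real.exp_pos _
    have h1 := mul_le_mul_of_nonneg_left (bernoulli_mgf_le (I.p_mem_Icc i) l)
      (mul_nonneg hE.le (Real.exp_pos (-(l ^ 2 / 8))).le)
    rw [mul_assoc (I.expDev l i s) _ (Real.exp (l ^ 2 / 8)), ← Real.exp_add, neg_add_cancel,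
      Real.exp_zero, mul_one] at h1
    have h2 := mul_le_mul_of_nonneg_left h1 (I.q_nonneg S i)
    simp only [if_true, Bool.false_eq_true, if_false]
    linarith
  · have (z : Fin n → Bool) : ¬ Triggered S z i := fun h => hi h.1
    simp [this, expectation_const]

theorem stateMean_expDev_le (l : ℝ) (i : Fin n) (t : ℕ) :
    I.stateMean O t (I.expDev l i) ≤ 1 := by
  induction t with
  | zero => simp [stateMean_zero, expDev, AlgState.init]
  | succ t ih =>
    rw [stateMean_succ]
    refine le_trans (I.stateMean_mono O t fun s _ => ?_) ih
    refine (expectation_mono _ fun S => I.expectation_expDev_next_le l i s S).trans_eq ?_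
    exact expectation_const _ _

/-- All the confidence intervals of round `t + 1` are correct. -/
def Concentrated (t : ℕ) (s : AlgState n) : Prop :=
  ∀ i, 0 < s.count i →
    |s.pHat i - I.p i| ≤ √(3 * Real.log ((t + 1 : ℕ) : ℝ) / (2 * s.count i))

open Classical in
-- The count is random, so a union bound is taken over arms, signs and all counts `1, …, t`; each
-- event has probability at most `(t + 1) ^ (-3)`.
theorem stateMean_not_concentrated_le (t : ℕ) :
    I.stateMean O t (fun s => if I.Concentrated t s then 0 else 1) ≤
      n * (t * (2 / ((t : ℝ) + 1) ^ 3)) := by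
  set L := Real.log ((t + 1 : ℕ) : ℝ) with hL
  have hL0 : 0 ≤ L := Real.log_natCast_nonneg _
  have hexp : Real.exp (-(3 * L)) = 1 / ((t : ℝ) + 1) ^ 3 := by
    have hcast : ((t + 1 : ℕ) : ℝ) = (t : ℝ) + 1 := by push_cast; ring
    rw [Real.exp_neg, mul_comm, Real.exp_mul, hL, Real.exp_log (by positivity), hcast, one_div]
    norm_cast
  let r : ℕ → ℝ := fun c => √(3 * L / (2 * c))
  have hdom (s : AlgState n) (hs : I.Valid t s) :
      (if I.Concentrated t s then (0 : ℝ) else 1) ≤ ∑ i, ∑ c ∈ Finset.Icc 1 t,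
        Real.exp (-(3 * L)) * (I.expDev (4 * r c) i s + I.expDev (-(4 * r c)) i s) := by
    have hnn (i : Fin n) (c : ℕ) : 0 ≤
        Real.exp (-(3 * L)) * (I.expDev (4 * r c) i s + I.expDev (-(4 * r c)) i s) := by
      unfold expDev; positivity
    split_ifs with h
    · exact Finset.sum_nonneg fun i _ => Finset.sum_nonneg fun c _ => hnn i c
    · simp only [Concentrated, not_forall, not_le] at h
      obtain ⟨i, hi, hdev⟩ := h
      refine le_trans ?_ (Finset.single_le_sum (fun i _ => Finset.sum_nonneg fun c _ => hnn i c)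
        (Finset.mem_univ i))
      refine le_trans ?_ (Finset.single_le_sum (fun c _ => hnn i c)
        (Finset.mem_Icc.2 ⟨hi, hs.count_le i⟩))
      have hc : (0 : ℝ) < s.count i := by exact_mod_cast hi
      have hr0 : 0 ≤ r (s.count i) := Real.sqrt_nonneg _
      have hr2 : s.count i * r (s.count i) ^ 2 = 3 / 2 * L := by
        rw [Real.sq_sqrt (by positivity)]
        field_simp
      -- The slope `l = ±4r` is the Chernoff optimum: the exponent is at least `c * (4r² - 2r²) =
      -- 2cr² = 3L`.
      have hkey (l : ℝ) (hl : l ^ 2 = 16 * r (s.count i) ^ 2)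
          (hd : 4 * r (s.count i) * r (s.count i) ≤ l * (s.pHat i - I.p i)) :
          1 ≤ Real.exp (-(3 * L)) * I.expDev l i s := by
        rw [expDev, ← Real.exp_add]
        refine Real.one_le_exp ?_
        have h3 := mul_le_mul_of_nonneg_left hd hc.le
        rw [hl]
        nlinarith
      have hp1 : 0 < Real.exp (-(3 * L)) * I.expDev (4 * r (s.count i)) i s := by
        unfold expDev; positivity
      have hp2 : 0 < Real.exp (-(3 * L)) * I.expDev (-(4 * r (s.count i))) i s := by
        unfold expDev; positivity
      rw [mul_add]
      rcases lt_abs.1 hdev with h1 | h1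
      · have := hkey (4 * r (s.count i)) (by ring)
          (mul_le_mul_of_nonneg_left h1.le (by positivity))
        linarith
      · have := hkey (-(4 * r (s.count i))) (by ring)
          ((mul_le_mul_of_nonneg_left h1.le (by positivity)).trans_eq (by ring))
        linarith
  refine (I.stateMean_mono O t hdom).trans ?_
  have hterm (i : Fin n) (l : ℝ) :
      expectation (I.runLaw O t) (fun h => I.expDev l i (I.stateAfter t h)) ≤ 1 :=
    I.stateMean_expDev_le O l i t
  simp only [stateMean, expectation_sum, expectation_const_mul, expectation_add]
  calc _ ≤ ∑ i : Fin n, ∑ c ∈ Finset.Icc 1 t, Real.exp (-(3 * L)) * (1 + 1) := by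
        gcongr <;> exact hterm _ _
    _ = _ := by
      rw [hexp]
      simp
      left; left; ring

end KMaxBandit.BinaryArms

namespace KMaxBandit

/-! ### The summed confidence radii -/

/-- Bound on the overestimation of an arm triggered `c` times, where `L` bounds `log t`. -/
noncomputable def radius (L : ℝ) (c : ℕ) : ℝ := if c = 0 then 1 else 2 * √(3 * L / (2 * c))

/-- The part of twice the confidence radius that exceeds `θ`. -/
noncomputable def excess (L θ : ℝ) (c : ℕ) : ℝ := max (2 * radius L c - θ) 0

theorem excess_nonneg (L θ : ℝ) (c : ℕ) : 0 ≤ excess L θ c := le_max_right _ _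

/-- The term `c = 0` is at most 2. For `c ≥ 1` the doubled radius is `A / √c`, and the excess
vanishes once `c ≥ (A / θ)²`; up to there the sum is at most `2A * (A / θ) = 48L / θ`. -/
theorem sum_excess_le {L θ : ℝ} (hL : 0 ≤ L) (hθ : 0 < θ) (m : ℕ) :
    ∑ c ∈ range m, excess L θ c ≤ 2 + 48 * L / θ := by
  set A := 4 * √(3 * L / 2) with hA
  have hA0 : 0 ≤ A := by positivity
  have hA2 : A ^ 2 = 24 * L := by
    rw [hA, mul_pow, Real.sq_sqrt (by positivity)]; ring
  have hind (m : ℕ) :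
      ∑ c ∈ range (m + 1), excess L θ c ≤ 2 + 2 * A * √(min (m : ℝ) ((A / θ) ^ 2)) := by
    induction m with
    | zero =>
      have : excess L θ 0 ≤ 2 := by simp [excess, radius, hθ.le]
      simpa [min_eq_left (sq_nonneg (A / θ))] using this
    | succ m ih =>
      rw [Finset.sum_range_succ]
      have hx : 0 < √((m : ℝ) + 1) := Real.sqrt_pos.2 (by positivity)
      have hx2 : √((m : ℝ) + 1) ^ 2 = m + 1 := Real.sq_sqrt (by positivity)
      have hr : 2 * radius L (m + 1) = A / √((m : ℝ) + 1) := by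
        rw [radius, if_neg (Nat.succ_ne_zero m), hA, ← div_div, Real.sqrt_div' _ (by positivity)]
        push_cast
        ring
      push_cast
      have hmono : √(min (m : ℝ) ((A / θ) ^ 2)) ≤ √(min ((m : ℝ) + 1) ((A / θ) ^ 2)) :=
        Real.sqrt_le_sqrt (min_le_min_right _ (by linarith))
      rcases le_or_gt (A / √((m : ℝ) + 1)) θ with h | h
      · have h0 : excess L θ (m + 1) = 0 := by
          rw [excess, hr]; exact max_eq_right (by linarith)
        have := mul_le_mul_of_nonneg_left hmono (mul_nonneg zero_le_two hA0)
        linarith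
      · have hM : (m : ℝ) + 1 ≤ (A / θ) ^ 2 := by
          rw [← hx2]
          refine pow_le_pow_left₀ hx.le ?_ 2
          rw [lt_div_iff₀ hx] at h
          rw [le_div_iff₀ hθ]
          linarith
        have he : excess L θ (m + 1) ≤ A / √((m : ℝ) + 1) := by
          rw [excess, hr]
          exact max_le (by linarith) (by positivity)
        rw [min_eq_left (by linarith)] at ih
        rw [min_eq_left hM]
        have hy2 : √(m : ℝ) ^ 2 = m := Real.sq_sqrt (by positivity)
        have hd : A / √((m : ℝ) + 1) ≤ 2 * A * (√((m : ℝ) + 1) - √(m : ℝ)) := by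
          rw [div_le_iff₀ hx]
          have : 1 ≤ 2 * (√((m : ℝ) + 1) - √(m : ℝ)) * √((m : ℝ) + 1) := by
            nlinarith [sq_nonneg (√((m : ℝ) + 1) - √(m : ℝ))]
          nlinarith
        linarith
  refine (Finset.sum_le_sum_of_subset_of_nonneg (Finset.range_mono (Nat.le_succ m))
    fun c _ _ => excess_nonneg L θ c).trans ((hind m).trans ?_)
  have h1 : √(min (m : ℝ) ((A / θ) ^ 2)) ≤ A / θ :=
    (Real.sqrt_le_sqrt (min_le_right _ _)).trans_eq (Real.sqrt_sq (by positivity))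
  have h2 : 2 * A * (A / θ) = 48 * L / θ := by
    rw [mul_div_assoc', show 2 * A * A = 2 * A ^ 2 by ring, hA2]; ring
  have := mul_le_mul_of_nonneg_left h1 (mul_nonneg zero_le_two hA0)
  linarith

/-- The terms are dominated by the telescoping differences `2 / (u + 1) - 2 / (u + 2)`. -/
theorem sum_failure_le (t : ℕ) :
    ∑ u ∈ range t, (u : ℝ) * (2 / ((u : ℝ) + 1) ^ 3) ≤ 2 := by
  have h : ∑ u ∈ range t, (u : ℝ) * (2 / ((u : ℝ) + 1) ^ 3) ≤ 2 - 2 / ((t : ℝ) + 1) := by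
    induction t with
    | zero => simp
    | succ t ih =>
      rw [Finset.sum_range_succ]
      have : (t : ℝ) * (2 / ((t : ℝ) + 1) ^ 3) ≤ 2 / ((t : ℝ) + 1) - 2 / ((t : ℝ) + 1 + 1) := by
        rw [div_sub_div _ _ (by positivity) (by positivity), mul_div_assoc',
          div_le_div_iff₀ (by positivity) (by positivity)]
        have h0 : (0 : ℝ) ≤ t := by positivity
        nlinarith [mul_nonneg h0 h0, pow_nonneg h0 3]
      push_cast
      linarith
  have : (0 : ℝ) ≤ 2 / ((t : ℝ) + 1) := by positivity
  linarith

namespace BinaryArms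

variable {n : ℕ} (I : BinaryArms n) {k : ℕ} {α β : ℝ} {O : Oracle n}

/-! ### Regret of one round -/

section Round

variable {I} {t : ℕ} {s : AlgState n}

theorem Valid.pBar_mem (hs : I.Valid t s) (i : Fin n) :
    s.pBar (t + 1) i ∈ Set.Icc (0 : ℝ) 1 :=
  ⟨le_min (add_nonneg (hs.pHat_mem i).1 (Real.sqrt_nonneg _)) zero_le_one, min_le_right _ _⟩

theorem Valid.vBar_mem (hs : I.Valid t s) (i : Fin n) : s.vBar i ∈ Set.Icc (0 : ℝ) 1 :=
  ⟨(I.v_pos i).le.trans (hs.vHat_mem i).1, (hs.vHat_mem i).2⟩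

theorem Valid.le_pBar (hs : I.Valid t s) (hc : I.Concentrated t s) (i : Fin n) :
    I.p i ≤ s.pBar (t + 1) i := by
  refine le_min ?_ (I.p_le_one i)
  rcases Nat.eq_zero_or_pos (s.count i) with h | h
  · rw [hs.pHat_eq_one i h]
    exact (I.p_le_one i).trans (le_add_of_nonneg_right (Real.sqrt_nonneg _))
  · linarith [(abs_le.1 (hc i h)).1]

theorem Valid.pBar_sub_le (hc : I.Concentrated t s) {L : ℝ}
    (hL : Real.log ((t + 1 : ℕ) : ℝ) ≤ L) (i : Fin n) :
    s.pBar (t + 1) i - I.p i ≤ radius L (s.count i) := by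
  unfold radius
  split_ifs with h
  · exact sub_le_iff_le_add.2 ((min_le_right _ _).trans (le_add_of_nonneg_right (I.p_pos i).le))
  · have h1 := (abs_le.1 (hc i (Nat.pos_of_ne_zero h))).2
    have h2 : s.pBar (t + 1) i ≤ _ := min_le_left _ _
    have h3 : √(3 * Real.log ((t + 1 : ℕ) : ℝ) / (2 * s.count i)) ≤
        √(3 * L / (2 * s.count i)) := by gcongr
    linarith

variable (I) in
/-- Expected increase of the potential when `S` is played. -/
noncomputable def drift (L : ℝ) (θ : Fin n → ℝ) (s : AlgState n) (S : Finset (Fin n)) : ℝ :=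
  ∑ i ∈ S, I.q S i * (excess L (θ i) (s.count i) + 2 * (I.p i * (s.vHat i - I.v i)))

theorem Valid.drift_nonneg (hs : I.Valid t s) (L : ℝ) (θ : Fin n → ℝ) (S : Finset (Fin n)) :
    0 ≤ I.drift L θ s S :=
  Finset.sum_nonneg fun i _ => mul_nonneg (I.q_nonneg S i) (add_nonneg (excess_nonneg _ _ _)
    (mul_nonneg zero_le_two (mul_nonneg (I.p_pos i).le (sub_nonneg.2 (hs.vHat_mem i).1))))

theorem Valid.gap_le (hs : I.Valid t s) (hc : I.Concentrated t s) {L : ℝ}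
    (hL : Real.log ((t + 1 : ℕ) : ℝ) ≤ L) (hα : 0 ≤ α) {θ : Fin n → ℝ} {B : ℝ} (hB : 0 ≤ B)
    {S : Finset (Fin n)} (hθ : 0 < I.gap k α S → ∑ i ∈ S, I.q S i * θ i ≤ I.gap k α S + B)
    (hS : α * maxOver (actions n k) (orderedReward (s.pBar (t + 1)) s.vBar) ≤
      orderedReward (s.pBar (t + 1)) s.vBar S) :
    I.gap k α S ≤ I.drift L θ s S + B := by
  rcases le_or_gt (I.gap k α S) 0 with h0 | h0
  · exact h0.trans (add_nonneg (hs.drift_nonneg L θ S) hB)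
  have hopt : I.opt k ≤ maxOver (actions n k) (orderedReward (s.pBar (t + 1)) s.vBar) := by
    refine maxOver_mono fun S' _ => ?_
    rw [I.reward_eq_orderedReward]
    -- The order matters: `p` is raised at the true decreasing values first, because the estimates
    -- of `v` need not be decreasing.
    exact (orderedReward_mono_left I.p_mem_Icc hs.pBar_mem (hs.le_pBar hc)
      (fun i => (I.v_pos i).le) I.v_strictAnti.antitone S').trans
      (orderedReward_mono_right hs.pBar_mem (fun i => (hs.vHat_mem i).1) S')
  have hgap : I.gap k α S = α * I.opt k - I.reward S := by
    refine max_eq_left ?_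
    by_contra h
    exact absurd h0 (by rw [gap, max_eq_right (not_le.1 h).le]; exact lt_irrefl _)
  have hsmooth := orderedReward_sub_le (v := I.v) I.p_mem_Icc hs.pBar_mem (hs.le_pBar hc)
    hs.vBar_mem S
  rw [← I.reward_eq_orderedReward] at hsmooth
  have h1 : I.gap k α S ≤ ∑ i ∈ S, I.q S i *
      (radius L (s.count i) + I.p i * (s.vHat i - I.v i)) := by
    have h : α * I.opt k - I.reward S ≤
        orderedReward (s.pBar (t + 1)) s.vBar S - I.reward S := by
      linarith [mul_le_mul_of_nonneg_left hopt hα]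
    rw [hgap]
    refine (h.trans hsmooth).trans (Finset.sum_le_sum fun i _ => ?_)
    rw [mul_comm]
    refine mul_le_mul_of_nonneg_left ?_ (I.q_nonneg S i)
    exact add_le_add (pBar_sub_le hc hL i) le_rfl
  -- The gap equals twice itself minus itself: the doubled bound is compared with `gap ≥ ∑ q * θ -
  -- B`, so only widths above the threshold are charged.
  have h2 : 2 * ∑ i ∈ S, I.q S i * (radius L (s.count i) + I.p i * (s.vHat i - I.v i)) -
      ∑ i ∈ S, I.q S i * θ i ≤ I.drift L θ s S := by
    rw [Finset.mul_sum, ← Finset.sum_sub_distrib]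
    refine Finset.sum_le_sum fun i _ => ?_
    have : 2 * radius L (s.count i) - θ i ≤ excess L (θ i) (s.count i) := le_max_left _ _
    linarith [mul_le_mul_of_nonneg_left this (I.q_nonneg S i)]
  linarith [hθ h0]

theorem Valid.round_regret_le_of_gap_le (hs : I.Valid t s) (hO : IsApproxOracle k α β O)
    (hα : 0 ≤ α) (hβ : β ≤ 1) {D : ℝ} (hD : ∀ S ∈ actions n k, I.gap k α S ≤ D) :
    α * β * I.opt k - expectation (O (s.pBar (t + 1)) s.vBar) I.reward ≤ D := by
  obtain ⟨hsupp, -⟩ := hO (s.pBar (t + 1)) s.vBar hs.pBar_mem hs.vBar_mem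
  have h1 : expectation (O (s.pBar (t + 1)) s.vBar) (fun _ => α * I.opt k) ≤
      expectation (O (s.pBar (t + 1)) s.vBar) (fun S => I.reward S + D) := by
    refine expectation_mono_support _ fun S hS => ?_
    have h2 : α * I.opt k - I.reward S ≤ I.gap k α S := le_max_left _ _
    linarith [hD S (hsupp S hS)]
  rw [expectation_const, expectation_add, expectation_const] at h1
  linarith [mul_le_mul_of_nonneg_left hβ (mul_nonneg hα (I.opt_nonneg k))]

open Classical in
-- The factor `β` is absorbed by the probability of oracle success, where `gap_le` applies. On
-- oracle failure the nonnegativity of reward and drift suffices, and a wrong interval costs at most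
-- `D`.
theorem Valid.round_regret_le (hs : I.Valid t s) (hO : IsApproxOracle k α β O) {L : ℝ}
    (hL : Real.log ((t + 1 : ℕ) : ℝ) ≤ L) (hα : 0 ≤ α) (hβ : β ≤ 1) {θ : Fin n → ℝ}
    {B D : ℝ} (hB : 0 ≤ B) (hD : ∀ S ∈ actions n k, I.gap k α S ≤ D)
    (hθ : ∀ S ∈ actions n k, 0 < I.gap k α S → ∑ i ∈ S, I.q S i * θ i ≤ I.gap k α S + B) :
    α * β * I.opt k - expectation (O (s.pBar (t + 1)) s.vBar) I.reward ≤
      expectation (O (s.pBar (t + 1)) s.vBar) (I.drift L θ s) + B +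
        D * (if I.Concentrated t s then 0 else 1) := by
  obtain ⟨hsupp, hprob⟩ := hO (s.pBar (t + 1)) s.vBar hs.pBar_mem hs.vBar_mem
  set μ := O (s.pBar (t + 1)) s.vBar
  have hαo : 0 ≤ α * I.opt k := mul_nonneg hα (I.opt_nonneg k)
  split_ifs with hc
  · have hβ' := mul_le_mul_of_nonneg_left (le_expectation_indicator μ hprob) hαo
    rw [← expectation_const_mul] at hβ'
    have : expectation μ (fun S => α * I.opt k * Set.indicator
        {S | α * maxOver (actions n k) (orderedReward (s.pBar (t + 1)) s.vBar) ≤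
          orderedReward (s.pBar (t + 1)) s.vBar S} 1 S) ≤
        expectation μ (fun S => (I.reward S + I.drift L θ s S) + B) := by
      refine expectation_mono_support μ fun S hS => ?_
      by_cases hmem : α * maxOver (actions n k) (orderedReward (s.pBar (t + 1)) s.vBar) ≤
          orderedReward (s.pBar (t + 1)) s.vBar S
      · rw [Set.indicator_of_mem (by exact hmem), Pi.one_apply, mul_one]
        have h1 := hs.gap_le hc hL hα hB (hθ S (hsupp S hS)) hmem
        have h2 : α * I.opt k - I.reward S ≤ I.gap k α S := le_max_left _ _
        linarith
      · rw [Set.indicator_of_notMem (by exact hmem), mul_zero]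
        exact add_nonneg (add_nonneg (I.reward_nonneg S) (hs.drift_nonneg L θ S)) hB
    rw [expectation_add, expectation_add, expectation_const] at this
    linarith
  · have h : 0 ≤ expectation μ (I.drift L θ s) :=
      (expectation_const μ 0).symm.trans_le (expectation_mono μ fun S => hs.drift_nonneg L θ S)
    linarith [hs.round_regret_le_of_gap_le hO hα hβ hD]

end Round

/-- Every round costs at most the largest gap. -/
theorem regret_le_of_gap_le (hO : IsApproxOracle k α β O) (hα : 0 ≤ α) (hβ : β ≤ 1) {D : ℝ}
    (hD : ∀ S ∈ actions n k, I.gap k α S ≤ D) (T : ℕ) : I.regret k α β O T ≤ D * T := by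
  induction T with
  | zero => simp [regret_zero]
  | succ T ih =>
    have h := (I.stateMean_mono O T fun s hs => hs.round_regret_le_of_gap_le hO hα hβ hD).trans_eq
      (I.stateMean_const O T D)
    rw [regret_succ]
    push_cast
    linarith

/-! ### The potential -/

/-- Contribution of arm `i` to the potential that pays for the regret. -/
noncomputable def armPotential (L θ : ℝ) (i : Fin n) (s : AlgState n) : ℝ :=
  ∑ c ∈ range (s.count i), excess L θ c - 2 * s.vHat i

/-- With probability `q` the arm is triggered and consumes its next excess; with probability `q * p`
it also wins, and `vHat` drops to `v`. These are the weights of the smoothness bound. -/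
theorem expectation_armPotential_next (L θ : ℝ) (i : Fin n) (s : AlgState n)
    (S : Finset (Fin n)) :
    expectation I.outcomeLaw (fun z => armPotential L θ i (I.next s S z)) =
      armPotential L θ i s + if i ∈ S then
        I.q S i * (excess L θ (s.count i) + 2 * (I.p i * (s.vHat i - I.v i))) else 0 := by
  have hpath (z : Fin n → Bool) : armPotential L θ i (I.next s S z) =
      if Triggered S z i then ∑ c ∈ range (s.count i + 1), excess L θ c -
        2 * (if z i then I.v i else s.vHat i) else armPotential L θ i s := by
    rw [armPotential, next_count, next_vHat]
    by_cases h : Triggered S z i <;> simp [h, armPotential]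
  simp only [hpath]
  split_ifs with hi
  · rw [I.expectation_triggered hi (fun b => ∑ c ∈ range (s.count i + 1), excess L θ c -
        2 * (if b then I.v i else s.vHat i)), Finset.sum_range_succ, armPotential]
    simp only [if_true, Bool.false_eq_true, if_false]
    ring
  · have (z : Fin n → Bool) : ¬ Triggered S z i := fun h => hi h.1
    simp [this, expectation_const]

theorem stateMean_potential_succ (O : Oracle n) (L : ℝ) (θ : Fin n → ℝ) (t : ℕ) :
    I.stateMean O (t + 1) (fun s => ∑ i, armPotential L (θ i) i s) =
      I.stateMean O t (fun s => ∑ i, armPotential L (θ i) i s) +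
        I.stateMean O t fun s => expectation (O (s.pBar (t + 1)) s.vBar) (I.drift L θ s) := by
  rw [stateMean_succ]
  simp only [expectation_sum, expectation_armPotential_next, Finset.sum_add_distrib]
  simp only [← Finset.sum_filter, Finset.filter_mem_eq_inter, Finset.univ_inter,
    expectation_add, expectation_const, stateMean]
  rfl

/-- The regret bound with a free threshold for every arm, from which all other bounds follow. -/
theorem regret_le_of_threshold (hO : IsApproxOracle k α β O) (hα : 0 ≤ α) (hβ : β ≤ 1)
    {θ : Fin n → ℝ} (hθpos : ∀ i, 0 < θ i) {B D : ℝ} (hB : 0 ≤ B) (hD0 : 0 ≤ D)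
    (hD : ∀ S ∈ actions n k, I.gap k α S ≤ D)
    (hθ : ∀ S ∈ actions n k, 0 < I.gap k α S → ∑ i ∈ S, I.q S i * θ i ≤ I.gap k α S + B)
    (T : ℕ) :
    I.regret k α β O T ≤ ∑ i, (4 + 48 * Real.log T / θ i) + B * T + 2 * n * D := by
  classical
  -- One `L` for all rounds keeps the potential independent of time.
  set L := Real.log T with hLdef
  have hL0 : 0 ≤ L := Real.log_natCast_nonneg T
  -- The term `2 * n` cancels the initial potential, where every `vHat` is 1.
  have hind (t : ℕ) (ht : t ≤ T) : I.regret k α β O t ≤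
      I.stateMean O t (fun s => ∑ i, armPotential L (θ i) i s) + 2 * n + B * t +
        D * (n * ∑ u ∈ range t, (u : ℝ) * (2 / ((u : ℝ) + 1) ^ 3)) := by
    induction t with
    | zero => simp [regret_zero, stateMean_zero, armPotential, AlgState.init, mul_comm]
    | succ t ih =>
      have hL : Real.log ((t + 1 : ℕ) : ℝ) ≤ L :=
        Real.log_le_log (by positivity) (by exact_mod_cast ht)
      have hstep := I.stateMean_mono O t fun s hs =>
        hs.round_regret_le hO hL hα hβ hB hD hθ
      have hsplit : I.stateMean O t (fun s =>
          expectation (O (s.pBar (t + 1)) s.vBar) (I.drift L θ s) + B +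
            D * (if I.Concentrated t s then 0 else 1)) =
          I.stateMean O t (fun s => expectation (O (s.pBar (t + 1)) s.vBar) (I.drift L θ s)) + B +
            D * I.stateMean O t (fun s => if I.Concentrated t s then 0 else 1) := by
        simp only [stateMean, expectation_add, expectation_const, expectation_const_mul]
      have hfail := mul_le_mul_of_nonneg_left (I.stateMean_not_concentrated_le O t) hD0
      rw [hsplit] at hstep
      rw [regret_succ, stateMean_potential_succ, Finset.sum_range_succ]
      push_cast
      linarith [ih (Nat.le_of_succ_le ht)]
  have hpot : I.stateMean O T (fun s => ∑ i, armPotential L (θ i) i s) ≤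
      ∑ i, (2 + 48 * L / θ i) := by
    refine (I.stateMean_mono O T (ψ := fun _ => ∑ i, (2 + 48 * L / θ i)) fun s hs => ?_).trans_eq
      (I.stateMean_const O T _)
    refine Finset.sum_le_sum fun i _ => ?_
    have := sum_excess_le hL0 (hθpos i) (s.count i)
    have := (hs.vBar_mem i).1
    simp only [AlgState.vBar] at this
    unfold armPotential
    linarith
  have hsum : ∑ i, (4 + 48 * L / θ i) = ∑ i, (2 + 48 * L / θ i) + 2 * n := by
    have (i : Fin n) : 4 + 48 * L / θ i = (2 + 48 * L / θ i) + 2 := by ring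
    simp only [this]
    rw [Finset.sum_add_distrib (g := fun _ => (2 : ℝ))]
    simp [mul_comm]
  have hfail : D * (n * ∑ u ∈ range T, (u : ℝ) * (2 / ((u : ℝ) + 1) ^ 3)) ≤ D * (n * 2) := by
    gcongr
    exact sum_failure_le T
  linarith [hind T le_rfl]

end BinaryArms

end KMaxBandit

namespace KMaxBandit.BinaryArms

variable {n : ℕ} (I : BinaryArms n) {k : ℕ} {α β : ℝ} {O : Oracle n}

/-! ### Gaps -/

theorem gap_nonneg (k : ℕ) (α : ℝ) (S : Finset (Fin n)) : 0 ≤ I.gap k α S := le_max_right _ _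

theorem gap_le_one (hα0 : 0 ≤ α) (hα : α ≤ 1) (S : Finset (Fin n)) : I.gap k α S ≤ 1 :=
  max_le (by nlinarith [I.opt_nonneg k, I.opt_le_one k, I.reward_nonneg S]) zero_le_one

theorem maxGap_nonneg (k : ℕ) (α : ℝ) : 0 ≤ I.maxGap k α := maxOver_nonneg _ _

theorem maxGap_le_one (hα0 : 0 ≤ α) (hα : α ≤ 1) : I.maxGap k α ≤ 1 :=
  maxOver_le_iff.2 ⟨zero_le_one, fun _ _ => maxOver_le_iff.2
    ⟨zero_le_one, fun S _ => I.gap_le_one hα0 hα S⟩⟩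

theorem mem_badActions {S : Finset (Fin n)} (hS : S ∈ actions n k) {i : Fin n} (hi : i ∈ S)
    (hq : 0 < I.q S i) (hgap : 0 < I.gap k α S) : S ∈ I.badActions k α i :=
  Finset.mem_filter.2 ⟨hS, hi, hq, mul_pos hq (I.p_pos i), hgap⟩

/-- A bad action triggers its first arm. -/
theorem exists_mem_badActions (hk : 0 < k) {S : Finset (Fin n)} (hS : S ∈ actions n k)
    (hgap : 0 < I.gap k α S) : ∃ i, S ∈ I.badActions k α i := by
  have hne : S.Nonempty := by
    rw [← Finset.card_pos, (Finset.mem_powersetCard.1 hS).2]; exact hk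
  have hempty : (S.filter fun j => j < S.min' hne) = ∅ :=
    Finset.filter_eq_empty_iff.2 fun j hj => not_lt.2 (Finset.min'_le S j hj)
  refine ⟨S.min' hne, I.mem_badActions hS (Finset.min'_mem S hne) ?_ hgap⟩
  rw [q, hempty, Finset.prod_empty]
  exact one_pos

theorem gap_le_maxGap (hk : 0 < k) {S : Finset (Fin n)} (hS : S ∈ actions n k) :
    I.gap k α S ≤ I.maxGap k α := by
  rcases le_or_gt (I.gap k α S) 0 with h | h
  · exact h.trans (I.maxGap_nonneg k α)
  · obtain ⟨i, hi⟩ := I.exists_mem_badActions hk hS h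
    exact (le_maxOver (f := I.gap k α) hi).trans
      (le_maxOver (f := fun i => I.armMaxGap k α i) (Finset.mem_univ i))

theorem armMinGap_pos (k : ℕ) (α : ℝ) (i : Fin n) : 0 < I.armMinGap k α i :=
  (I.minGap_pos k α).trans_le (Finset.inf_le (Finset.mem_univ i))

theorem ratio_nonneg (k : ℕ) (α : ℝ) (i : Fin n) : 0 ≤ I.ratio k α i := ENNReal.toReal_nonneg

/-- The threshold is the least gap over `k`. An arm without bad actions has no constraint, and `48 *
L + 1` makes its cost at most 1, hence the extra `+ 1`. -/
theorem exists_threshold (hk : 0 < k) (α : ℝ) {L : ℝ} (hL : 0 ≤ L) (i : Fin n) :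
    ∃ θ : ℝ, 0 < θ ∧ 48 * L / θ ≤ 48 * L * I.ratio k α i + 1 ∧
      ∀ S ∈ I.badActions k α i, θ ≤ I.gap k α S / k := by
  have hk' : (0 : ℝ) < k := by exact_mod_cast hk
  by_cases htop : I.armMinGap k α i = ∞
  · refine ⟨48 * L + 1, by positivity, ?_, fun S hS => ?_⟩
    · have h1 : 48 * L / (48 * L + 1) ≤ 1 := div_le_one_of_le₀ (by linarith) (by positivity)
      have h2 := mul_nonneg (mul_nonneg (show (0 : ℝ) ≤ 48 by norm_num) hL) (I.ratio_nonneg k α i)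
      linarith
    · have h : I.armMinGap k α i ≤ ENNReal.ofReal (I.gap k α S) := Finset.inf_le hS
      rw [htop, top_le_iff] at h
      exact absurd h ENNReal.ofReal_ne_top
  · have hpos : 0 < (I.armMinGap k α i).toReal :=
      ENNReal.toReal_pos (I.armMinGap_pos k α i).ne' htop
    refine ⟨(I.armMinGap k α i).toReal / k, by positivity, ?_, fun S hS => ?_⟩
    · rw [ratio, ENNReal.toReal_div, ENNReal.toReal_natCast]
      have : 48 * L / ((I.armMinGap k α i).toReal / k) =
          48 * L * (k / (I.armMinGap k α i).toReal) := by field_simp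
      linarith
    · have h : I.armMinGap k α i ≤ ENNReal.ofReal (I.gap k α S) := Finset.inf_le hS
      have := ENNReal.toReal_mono ENNReal.ofReal_ne_top h
      rw [ENNReal.toReal_ofReal (I.gap_nonneg k α S)] at this
      gcongr

/-! ### The regret bounds -/

theorem regret_le_ratio (hO : IsApproxOracle k α β O) (hk : 0 < k) (hα : 0 ≤ α) (hβ : β ≤ 1)
    (T : ℕ) : I.regret k α β O T ≤
      ∑ i, (5 + 48 * Real.log T * I.ratio k α i) + 2 * n * I.maxGap k α := by
  have hL : 0 ≤ Real.log T := Real.log_natCast_nonneg T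
  have hk' : (0 : ℝ) < k := by exact_mod_cast hk
  choose θ hpos hle hbad using I.exists_threshold hk α hL
  have h := I.regret_le_of_threshold hO hα hβ hpos le_rfl (I.maxGap_nonneg k α)
    (fun S hS => I.gap_le_maxGap hk hS) (fun S hS hgap => ?_) T
  · have h2 : ∑ i, (4 + 48 * Real.log T / θ i) ≤ ∑ i, (5 + 48 * Real.log T * I.ratio k α i) :=
      Finset.sum_le_sum fun i _ => by linarith [hle i]
    linarith
  · have hterm : ∀ i ∈ S, I.q S i * θ i ≤ I.gap k α S / k := fun i hi => by
      rcases (I.q_nonneg S i).eq_or_lt with hq | hq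
      · rw [← hq, zero_mul]; positivity
      · have h1 := hbad i S (I.mem_badActions hS hi hq hgap)
        exact (mul_le_of_le_one_left (hpos i).le (I.q_le_one S i)).trans h1
    refine (Finset.sum_le_sum hterm).trans_eq ?_
    rw [Finset.sum_const, (Finset.mem_powersetCard.1 hS).2, nsmul_eq_mul, add_zero,
      mul_div_cancel₀ _ hk'.ne']

theorem one_le_two_mul_log {T : ℕ} (hT : 2 ≤ T) : 1 ≤ 2 * Real.log T := by
  have h : Real.log 2 ≤ Real.log T := Real.log_le_log two_pos (by exact_mod_cast hT)
  linarith [Real.log_two_gt_d9]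

theorem regret_le_minGap (hO : IsApproxOracle k α β O) (hk : 0 < k) (hα0 : 0 ≤ α)
    (hα : α ≤ 1) (hβ : β ≤ 1) {T : ℕ} (hT : 2 ≤ T) : I.regret k α β O T ≤
      62 * ((n * k : ℝ≥0∞) / I.minGap k α).toReal * Real.log T := by
  have hL := one_le_two_mul_log hT
  by_cases hbad : ∃ i S, S ∈ I.badActions k α i
  · obtain ⟨i, S, hS⟩ := hbad
    have hmin : I.minGap k α ≤ 1 := by
      refine (Finset.inf_le (Finset.mem_univ i)).trans ((Finset.inf_le hS).trans ?_)
      exact ENNReal.ofReal_le_one.2 (I.gap_le_one hα0 hα S)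
    set r := ((k : ℝ≥0∞) / I.minGap k α).toReal with hr
    have hfin : (k : ℝ≥0∞) / I.minGap k α ≠ ∞ :=
      ENNReal.div_ne_top (ENNReal.natCast_ne_top k) (I.minGap_pos k α).ne'
    have hratio (j : Fin n) : I.ratio k α j ≤ r :=
      ENNReal.toReal_mono hfin (ENNReal.div_le_div_left (Finset.inf_le (Finset.mem_univ j)) _)
    have hr1 : 1 ≤ r := by
      rw [hr, ← ENNReal.toReal_one]
      refine ENNReal.toReal_mono hfin ?_
      rw [ENNReal.le_div_iff_mul_le (.inl (I.minGap_pos k α).ne')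
        (.inl (hmin.trans_lt ENNReal.one_lt_top).ne), one_mul]
      exact hmin.trans (by exact_mod_cast hk)
    have heq : ((n * k : ℝ≥0∞) / I.minGap k α).toReal = n * r := by
      rw [mul_div_assoc, ENNReal.toReal_mul, ENNReal.toReal_natCast]
    have hsum : ∑ i, (5 + 48 * Real.log T * I.ratio k α i) ≤ n * (5 + 48 * Real.log T * r) := by
      refine (Finset.sum_le_sum (g := fun _ => 5 + 48 * Real.log T * r) fun j _ => ?_).trans_eq
        (by simp [mul_add])
      have := mul_le_mul_of_nonneg_left (hratio j)
        (show 0 ≤ 48 * Real.log T by linarith)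
      linarith
    have hD := mul_le_mul_of_nonneg_left (I.maxGap_le_one (k := k) hα0 hα)
      (show (0 : ℝ) ≤ 2 * n by positivity)
    -- The constants `5 + 2` per arm are absorbed using `r ≥ 1` and `2 * log T ≥ 1`, which gives `62
    -- = 48 + 14`.
    have h7 : 7 ≤ 14 * r * Real.log T := by nlinarith
    have h7n := mul_le_mul_of_nonneg_left h7 (Nat.cast_nonneg (α := ℝ) n)
    rw [heq]
    linarith [I.regret_le_ratio hO hk hα0 hβ T]
  · have hD (S : Finset (Fin n)) (hS : S ∈ actions n k) : I.gap k α S ≤ 0 := by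
      by_contra h
      obtain ⟨i, hi⟩ := I.exists_mem_badActions hk hS (not_le.1 h)
      exact hbad ⟨i, S, hi⟩
    refine (I.regret_le_of_gap_le hO hα0 hβ hD T).trans ?_
    rw [zero_mul]
    exact mul_nonneg (mul_nonneg (by norm_num) ENNReal.toReal_nonneg) (by linarith)

theorem regret_le_sqrt (hO : IsApproxOracle k α β O) (hk : 0 < k) (hkn : k ≤ n) (hα0 : 0 ≤ α)
    (hα : α ≤ 1) (hβ : β ≤ 1) {T : ℕ} (hT : 2 ≤ T) : I.regret k α β O T ≤
      110 * √((n : ℝ) * k * T) * Real.log T := by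
  have hL := one_le_two_mul_log hT
  set L := Real.log T
  have hL0 : 0 < L := by linarith
  have hk' : (1 : ℝ) ≤ k := by exact_mod_cast hk
  have hn' : (1 : ℝ) ≤ n := by exact_mod_cast hk.trans_le hkn
  have hT' : (2 : ℝ) ≤ T := by exact_mod_cast hT
  set R := √((n : ℝ) * k * T) with hR
  have hR0 : 0 < R := Real.sqrt_pos.2 (by positivity)
  have hRL : R ≤ 2 * (R * L) := by nlinarith
  have hD (S : Finset (Fin n)) (_ : S ∈ actions n k) : I.gap k α S ≤ 1 := I.gap_le_one hα0 hα S
  rcases le_total (T : ℝ) n with hTn | hnT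
  · have h1 := I.regret_le_of_gap_le hO hα0 hβ hD T
    have h2 : (T : ℝ) ≤ R := Real.le_sqrt_of_sq_le (by
      nlinarith [mul_le_mul_of_nonneg_right hk' (by positivity : (0 : ℝ) ≤ n * T)])
    have : 0 < R * L := by positivity
    linarith
  -- This choice balances `n * L / ε` against `k * ε * T`; both equal `R * √L`. With `n ≤ R`, the
  -- total `6n + 49 * R * √L` is at most `(12 + 98) * R * L`.
  · set ε := √((n : ℝ) * L / (k * T)) with hε
    have hε0 : 0 < ε := Real.sqrt_pos.2 (by positivity)
    have hε2 : ε ^ 2 = n * L / (k * T) := Real.sq_sqrt (by positivity)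
    have h := I.regret_le_of_threshold (θ := fun _ => ε) (B := k * ε) hO hα0 hβ (fun _ => hε0)
      (by positivity) zero_le_one hD (fun S hS _ => ?_) T
    · have hkT : k * ε * T = R * √L := by
        rw [hR, ← Real.sqrt_mul (by positivity), ← Real.sqrt_sq (show 0 ≤ k * ε * T by positivity)]
        congr 1
        rw [mul_pow, mul_pow, hε2]
        field_simp
      have hnL : n * (L / ε) = R * √L := by
        rw [← hkT]
        have : (k * T) * ε ^ 2 = n * L := by rw [hε2]; field_simp
        field_simp
        linarith
      have hs : √L ≤ 2 * L := by
        refine Real.sqrt_le_iff.2 ⟨by positivity, ?_⟩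
        nlinarith
      have hnR : (n : ℝ) ≤ R := Real.le_sqrt_of_sq_le (by
        nlinarith [mul_le_mul_of_nonneg_right hk' (by positivity : (0 : ℝ) ≤ n * T)])
      have hRs := mul_le_mul_of_nonneg_left hs hR0.le
      have hsum : ∑ _i : Fin n, (4 + 48 * L / ε) = 4 * n + 48 * (n * (L / ε)) := by
        simp; ring
      rw [hsum, hnL, hkT] at h
      linarith
    · have : ∑ i ∈ S, I.q S i * ε ≤ k * ε := by
        rw [← Finset.sum_mul]
        gcongr
        refine (Finset.sum_le_card_nsmul S _ 1 fun i _ => I.q_le_one S i).trans_eq ?_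
        rw [(Finset.mem_powersetCard.1 hS).2]
        simp
      linarith [I.gap_nonneg k α S]

end KMaxBandit.BinaryArms

/-! ### Assembling the bounds and the constants. -/

theorem theorem1 :
    ∃ c₁ c₂ c₃ c₄ : ℝ, 0 < c₁ ∧ 0 < c₂ ∧ 0 < c₃ ∧ 0 < c₄ ∧
      ∀ (n k : ℕ) (I : KMaxBandit.BinaryArms n) (α β : ℝ) (O : KMaxBandit.Oracle n) (T : ℕ),
        0 < k → k ≤ n → 0 < α → α ≤ 1 → 0 < β → β ≤ 1 →
        KMaxBandit.IsApproxOracle k α β O → 1 ≤ T →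
        (I.regret k α β O T ≤
          c₁ * (∑ i, (I.ratio k α i + Real.log (I.ratio k α i + 1))) * Real.log T +
          c₂ * ∑ i, ((Real.log (I.ratio k α i + 1) + 1) * I.maxGap k α + 1)) ∧
        (2 ≤ T →
          I.regret k α β O T ≤ c₃ * ((n * k : ℝ≥0∞) / I.minGap k α).toReal * Real.log T) ∧
        (2 ≤ T →
          I.regret k α β O T ≤ c₄ * √((n : ℝ) * k * T) * Real.log T) := by
  refine ⟨48, 5, 62, 110, by norm_num, by norm_num, by norm_num, by norm_num, ?_⟩
  intro n k I α β O T hk hkn hα0 hα _ hβ hO _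
  refine ⟨?_, fun hT => I.regret_le_minGap hO hk hα0.le hα hβ hT,
    fun hT => I.regret_le_sqrt hO hk hkn hα0.le hα hβ hT⟩
  refine (I.regret_le_ratio hO hk hα0.le hβ T).trans ?_
  have hn : 2 * n * I.maxGap k α = ∑ _i : Fin n, 2 * I.maxGap k α := by simp; ring
  rw [hn, ← Finset.sum_add_distrib, Finset.mul_sum, Finset.sum_mul, Finset.mul_sum,
    ← Finset.sum_add_distrib]
  refine Finset.sum_le_sum fun i _ => ?_
  have hlog : 0 ≤ Real.log (I.ratio k α i + 1) :=
    Real.log_nonneg (by linarith [I.ratio_nonneg k α i])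
  have hL : 0 ≤ Real.log T := Real.log_natCast_nonneg T
  have hM := I.maxGap_nonneg k α
  -- The logarithmic terms of the bound are pure slack: only their sign is used.
  linarith [mul_nonneg hlog hL, mul_nonneg hlog hM]
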